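/- Consider a zero-sum perfect-information stochastic game with finite state space $S=\{1,\dots,n\}$, nonempty finite action sets $A_i$ ($i\in S$) of player MIN and $B_{i,a}$ ($i\in S$, $a\in A_i$) of player MAX, and fixed transition probabilities $P_i^{ab}$, each a probability (row) vector on $S$. Let $\mathcal R\cong\mathbb R^q$ be the space of transition payments $r=(r_i^{ab})_{i\in S,\,a\in A_i,\,b\in B_{i,a}}$. For $r\in\mathcal R$, and for a policy $\sigma$ of MIN (a map $i\mapsto\sigma(i)\in A_i$), define $T_r,\,T_r^{\sigma}:\mathbb R^n\to\mathbb R^n$ by $$[T_r(x)]_i=\min_{a\in A_i}\max_{b\in B_{i,a}}\bigl(r_i^{ab}+P_i^{ab}x\bigr),\qquad [T_r^{\sigma}(x)]_i=\max_{b\in B_{i,\sigma(i)}}\bigl(r_i^{\sigma(i)b}+P_i^{\sigma(i)b}x\bigr).$$ A scalar $\lambda$ is an eigenvalue of an operator $F:\mathbb R^n\to\mathbb R^n$, with bias vector $u\in\mathbb R^n$, if $F(u)=\lambda\mathbf 1+u$, where $\mathbf 1=(1,\dots,1)$. Hoffman–Karp policy iteration for $T_r$ selects an arbitrary policy $\sigma_0$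 of MIN and then, for $k=0,1,2,\dots$, until $\sigma_{k+1}=\sigma_k$: (1) computes an eigenvalue $\lambda^k$ and a bias vector $v^k$ of $T_r^{\sigma_k}$; (2) chooses a policy $\sigma_{k+1}$ of MIN such that $T_r(v^k)=T_r^{\sigma_{k+1}}(v^k)$, taking $\sigma_{k+1}=\sigma_k$ whenever this is possible. When $\sigma_{k+1}=\sigma_k$ it stops and returns $\lambda^k$ and $v^k$. An execution (a sequence of such choices of $\sigma_k$ and $(\lambda^k,v^k)$) is well posed if, at each step $k$ that it reaches, $T_r^{\sigma_k}$ has an eigenvalue. A polyhedral fan is a finite set $\mathcal K$ of polyhedral cones such that every (nonempty) face of a cone of $\mathcal K$ belongs to $\mathcal K$, and the intersection of any two cones of $\mathcal K$ is a face of both. Theorem. There is a polyhedral fan in $\mathcal R$ (depending only on the state space, the action sets and the transition probabilities), whose cones cover $\mathcal R$, such that for each payment $r$ in the interior of a full-dimensional cone of the fan, every well-posed execution of Hoffman–Karp policy iteration for $T_r$ terminates after finitely many steps, and the returned $\lambda$ and $u$ are an eigenvalue and a bias vector of $T_r$, that is, $T_r(u)=\lambda\mathbf 1+u$. -/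

import Mathlib

/-- A polyhedral fan in a real vector space `E`: a finite set of polyhedral cones (solution sets of
finitely many homogeneous linear inequalities) that contains every face of each of its cones and in
which any two cones meet in a common face. -/
structure IsPolyhedralFan {E : Type*} [AddCommGroup E] [Module ℝ E]
    (K : Set (PointedCone ℝ E)) : Prop where
  finite : K.Finite
  polyhedral : ∀ C ∈ K, C.DualFG (LinearMap.id : Module.Dual ℝ E →ₗ[ℝ] Module.Dual ℝ E)
  face_mem : ∀ C ∈ K, ∀ F : PointedCone ℝ E, F.IsFaceOf C → F ∈ K
  inter_isFaceOf : ∀ C ∈ K, ∀ D ∈ K, (C ⊓ D).IsFaceOf C ∧ (C ⊓ D).IsFaceOf D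

/-- A set of cones covers the ambient space. -/
def Covers {E : Type*} [AddCommGroup E] [Module ℝ E] (K : Set (PointedCone ℝ E)) : Prop :=
  ∀ x : E, ∃ C ∈ K, x ∈ C

/-- A cone is full-dimensional when it spans the ambient space. -/
def IsFullDimensional {E : Type*} [AddCommGroup E] [Module ℝ E] (C : PointedCone ℝ E) : Prop :=
  Submodule.span ℝ (C : Set E) = ⊤

/-- `lam` is an eigenvalue of `F` with bias vector (eigenvector) `u`: `F u = lam 𝟏 + u`. -/
def IsEigenpair {S : Type*} (F : (S → ℝ) → (S → ℝ)) (lam : ℝ) (u : S → ℝ) : Prop :=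
  ∀ i, F u i = lam + u i

/-- The operator `F` has an eigenvalue. -/
def HasEigenvalue {S : Type*} (F : (S → ℝ) → (S → ℝ)) : Prop :=
  ∃ (lam : ℝ) (u : S → ℝ), IsEigenpair F lam u

namespace Game

/-- The space of transition payments `r i a b`, for `a` an action of MIN in state `i` and `b` an
action of MAX in state `i` after `a`. -/
abbrev Payment {S : Type*} {A : S → Type*} (B : ∀ i, A i → Type*) : Type _ :=
  ∀ (i : S) (a : A i), B i a → ℝ

/-- Policies of player MIN. -/
abbrev Policy {S : Type*} (A : S → Type*) : Type _ := ∀ i : S, A i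

section

variable {S : Type*} [Fintype S] {A : S → Type*} [∀ i, Fintype (A i)] [∀ i, Nonempty (A i)]
  {B : ∀ i, A i → Type*} [∀ i a, Fintype (B i a)] [∀ i a, Nonempty (B i a)]
  (P : ∀ (i : S) (a : A i), B i a → stdSimplex ℝ S) (r : Payment B)

/-- `max_{b ∈ B i a} (r i a b + P i a b x)`. -/
noncomputable def maxValue (x : S → ℝ) (i : S) (a : A i) : ℝ :=
  Finset.univ.sup' Finset.univ_nonempty fun b : B i a => r i a b + ∑ j, (P i a b).1 j * x j

/-- The Shapley operator `T_r`. -/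
noncomputable def shapley (x : S → ℝ) : S → ℝ := fun i =>
  Finset.univ.inf' Finset.univ_nonempty fun a : A i => maxValue P r x i a

/-- The operator `T_r^σ` of the one-player game in which MIN plays the policy `σ`. -/
noncomputable def policyOp (σ : Policy A) (x : S → ℝ) : S → ℝ := fun i =>
  maxValue P r x i (σ i)

/-- With MIN's successive policies `σ 0, σ 1, …`, step `k` of the policy iteration is reached: no
earlier step stopped the iteration by `σ (j + 1) = σ j`, and at each earlier step the operator of
the current policy had an eigenvalue. -/
def Reached (σ : ℕ → Policy A) (k : ℕ) : Prop :=
  ∀ j < k, HasEigenvalue (policyOp P r (σ j)) ∧ σ (j + 1) ≠ σ j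

/-- `σ`, `lam`, `v` record an execution of Hoffman–Karp policy iteration, from an arbitrary initial
policy `σ 0`. At every reached step `k` at which `T_r^{σ k}` has an eigenvalue,
`lam k` and `v k` are an eigenvalue and a bias vector of `T_r^{σ k}`, and `σ (k + 1)` is an optimal
policy for `v k`, equal to `σ k` whenever `σ k` itself is optimal for `v k`.
Entries that come after the end of the execution are not constrained. -/
structure IsExecution (σ : ℕ → Policy A) (lam : ℕ → ℝ) (v : ℕ → S → ℝ) : Prop where
  eigenpair : ∀ k, Reached P r σ k → HasEigenvalue (policyOp P r (σ k)) →
    IsEigenpair (policyOp P r (σ k)) (lam k) (v k)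
  optimal : ∀ k, Reached P r σ k → HasEigenvalue (policyOp P r (σ k)) →
    shapley P r (v k) = policyOp P r (σ (k + 1)) (v k)
  conservative : ∀ k, Reached P r σ k → HasEigenvalue (policyOp P r (σ k)) →
    shapley P r (v k) = policyOp P r (σ k) (v k) → σ (k + 1) = σ k

/-- The execution is well posed: at each step that is reached, `T_r^{σ k}` has an eigenvalue. -/
def WellPosed (σ : ℕ → Policy A) : Prop :=
  ∀ k, Reached P r σ k → HasEigenvalue (policyOp P r (σ k))

/-- The execution reaches step `k` and stops there, the stopping test `σ (k + 1) = σ k` being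
satisfied; it then returns the pair `lam k`, `v k`. -/
def StopsAt (σ : ℕ → Policy A) (k : ℕ) : Prop :=
  Reached P r σ k ∧ HasEigenvalue (policyOp P r (σ k)) ∧ σ (k + 1) = σ k

end

end Game

/-! ### The fan of a finite hyperplane arrangement. -/

section SignCone

variable {E : Type*} [AddCommGroup E] [Module ℝ E] {ι : Type*}

/-! The fan comes from a hyperplane arrangement. For each pair of joint policies whose Poisson
equations share an eigenvalue only on a proper subspace of payments, one hyperplane contains that
subspace. A payment interior to a cone lies on none of these hyperplanes, hence is generic.

For generic `r`, all joint policies with the same eigenvalue have a state `i` common to all their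
closed classes (`IsGeneric.exists_mem_isClosedClass`). If an execution never stopped, some policy
would recur; eigenvalues never increase, so they are constant along the cycle. Each difference of
successive biases is then superharmonic for the chain of the next policy, so its minimisers form a
closed class and include `i`. Telescoping around the cycle makes these differences constant, so the
current policy was already optimal and the conservative rule would have stopped the iteration. -/

/-- The closed cone of the points at which each functional `f j` vanishes or has the sign `s j`. -/
def signCone (f : ι → Module.Dual ℝ E) (s : ι → SignType) : PointedCone ℝ E where
  carrier := {x | ∀ j, 0 ≤ (s j : ℝ) * f j x ∧ (s j = 0 → f j x = 0)}
  zero_mem' := by simp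
  add_mem' {x y} hx hy j := by
    refine ⟨?_, fun h => ?_⟩
    · rw [map_add, mul_add]
      exact add_nonneg (hx j).1 (hy j).1
    · rw [map_add, (hx j).2 h, (hy j).2 h, add_zero]
  smul_mem' c x hx j := by
    rw [← Nonneg.coe_smul, map_smul, smul_eq_mul]
    refine ⟨?_, fun h => ?_⟩
    · rw [mul_left_comm]
      exact mul_nonneg c.2 (hx j).1
    · rw [(hx j).2 h, mul_zero]

theorem mem_signCone {f : ι → Module.Dual ℝ E} {s : ι → SignType} {x : E} :
    x ∈ signCone f s ↔ ∀ j, 0 ≤ (s j : ℝ) * f j x ∧ (s j = 0 → f j x = 0) :=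
  Iff.rfl

theorem signCone_dualFG [Finite ι] (f : ι → Module.Dual ℝ E) (s : ι → SignType) :
    (signCone f s).DualFG (LinearMap.id : Module.Dual ℝ E →ₗ[ℝ] Module.Dual ℝ E) := by
  have h : signCone f s = PointedCone.dual (LinearMap.id : Module.Dual ℝ E →ₗ[ℝ] Module.Dual ℝ E)
      (Set.range (fun j => (s j : ℝ) • f j) ∪
        (f '' {j | s j = 0} ∪ (fun j => -f j) '' {j | s j = 0})) := by
    ext x
    rw [mem_signCone, PointedCone.mem_dual]
    constructor
    · rintro h g (⟨j, rfl⟩ | ⟨j, hj, rfl⟩ | ⟨j, hj, rfl⟩)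
      · simpa using (h j).1
      · simpa using ((h j).2 hj).ge
      · simpa using ((h j).2 hj).le
    · intro h j
      refine ⟨by simpa using h (Or.inl ⟨j, rfl⟩), fun hj => le_antisymm ?_ ?_⟩
      · simpa using h (Or.inr (Or.inr ⟨j, hj, rfl⟩))
      · simpa using h (Or.inr (Or.inl ⟨j, hj, rfl⟩))
  rw [h]
  exact PointedCone.DualFG.dual_of_finite _
    ((Set.finite_range _).union ((Set.toFinite _).union (Set.toFinite _)))

theorem signCone_isFaceOf {f : ι → Module.Dual ℝ E} {s t : ι → SignType}
    (h : ∀ j, t j = s j ∨ t j = 0) : (signCone f t).IsFaceOf (signCone f s) where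
  le x hx j := by
    rcases h j with hj | hj
    · exact hj ▸ hx j
    · simp [(hx j).2 hj]
  mem_of_smul_add_mem {x y a} hx hy ha hxy j := by
    rcases h j with hj | hj
    · rw [hj]
      exact hx j
    · suffices h0 : f j x = 0 by simp [h0]
      have h1 := (hxy j).2 hj
      rw [map_add, map_smul, smul_eq_mul] at h1
      by_cases hs : s j = 0
      · exact (hx j).2 hs
      · have hs' : (s j : ℝ) ≠ 0 := by
          cases hsj : s j <;> simp_all
        have h2 : a * ((s j : ℝ) * f j x) + (s j : ℝ) * f j y = 0 := by
          linear_combination (s j : ℝ) * h1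
        have h3 := mul_nonneg ha.le (hx j).1
        have h4 : a * ((s j : ℝ) * f j x) = 0 := by linarith [(hy j).1]
        simpa [ha.ne', hs'] using h4

theorem signCone_inf (f : ι → Module.Dual ℝ E) (s t : ι → SignType) :
    signCone f s ⊓ signCone f t = signCone f fun j => if s j = t j then s j else 0 := by
  ext x
  rw [Submodule.mem_inf, mem_signCone, mem_signCone, mem_signCone, ← forall_and]
  refine forall_congr' fun j => ?_
  by_cases h : s j = t j
  · simp [h]
  · rw [if_neg h]
    constructor
    · rintro ⟨⟨h1, h2⟩, h3, h4⟩
      suffices h0 : f j x = 0 by simp [h0]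
      cases hs : s j <;> cases ht : t j <;> simp_all <;> linarith
    · rintro ⟨-, h⟩
      simp [h rfl]

/-- Inequalities strict at `x` survive a small perturbation, and the others are tight along `y` as
well. -/
theorem exists_pos_sub_smul_mem_signCone [Finite ι] {f : ι → Module.Dual ℝ E} {s : ι → SignType}
    {x y : E} (hx : x ∈ signCone f s) (hy : y ∈ signCone f s)
    (hxy : ∀ j, f j x = 0 → f j y = 0) :
    ∃ ε : ℝ, 0 < ε ∧ x - ε • y ∈ signCone f s := by
  have h : ∀ j, ∃ ε : ℝ, 0 < ε ∧ ∀ δ, 0 < δ → δ ≤ ε → δ * ((s j : ℝ) * f j y) ≤ s j * f j x := by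
    intro j
    rcases (hx j).1.eq_or_lt with h0 | h0
    · refine ⟨1, one_pos, fun δ _ _ => ?_⟩
      rw [← h0]
      rcases mul_eq_zero.1 h0.symm with h1 | h1
      · simp [h1]
      · simp [hxy j h1]
    -- The `+ 1` keeps the denominator positive when `f j y = 0`.
    · refine ⟨s j * f j x / (s j * f j y + 1), div_pos h0 (by linarith [(hy j).1]),
        fun δ hδ hle => ?_⟩
      rw [le_div_iff₀ (by linarith [(hy j).1])] at hle
      nlinarith
  choose ε hε hle using h
  obtain ⟨δ, hδ, hδε⟩ : ∃ δ : ℝ, 0 < δ ∧ ∀ j, δ ≤ ε j := by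
    cases isEmpty_or_nonempty ι
    · exact ⟨1, one_pos, fun j => isEmptyElim j⟩
    · obtain ⟨j, hj⟩ := Finite.exists_min ε
      exact ⟨ε j, hε j, hj⟩
  refine ⟨δ, hδ, fun j => ⟨?_, fun hj => ?_⟩⟩
  · have := hle j δ hδ (hδε j)
    rw [map_sub, map_smul, smul_eq_mul]
    linarith
  · rw [map_sub, map_smul, (hx j).2 hj, (hy j).2 hj, smul_zero, sub_zero]

/-- A point `x` of `F` with maximal support is relatively interior: the functionals vanishing at `x`
vanish on `F`. Conversely, if `y` in the cone satisfies these equations, then `x` is the sum of `ε •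
y` and a point of the cone, so the face property puts `y` in `F`. -/
theorem PointedCone.IsFaceOf.eq_signCone [Finite ι] {f : ι → Module.Dual ℝ E}
    {s : ι → SignType} {F : PointedCone ℝ E} (hF : F.IsFaceOf (signCone f s)) :
    ∃ t, F = signCone f t := by
  classical
  have hne : (Set.range fun x : F => {j | f j (x : E) ≠ 0}).Nonempty := ⟨_, ⟨0, rfl⟩⟩
  obtain ⟨_, ⟨⟨x, hx⟩, rfl⟩, hmax⟩ := (Set.toFinite
    (Set.range fun x : F => {j | f j (x : E) ≠ 0})).exists_maximal hne
  have hzero : ∀ y ∈ F, ∀ j, f j x = 0 → f j y = 0 := by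
    intro y hy j hj
    by_contra hyj
    have hle : {j | f j x ≠ 0} ≤ {j | f j (x + y) ≠ 0} := by
      intro i hi h0
      apply hi
      have h1 := (hF.le hx i).1
      have h2 := (hF.le hy i).1
      rw [map_add] at h0
      have h3 : (s i : ℝ) * f i x + s i * f i y = 0 := by linear_combination (s i : ℝ) * h0
      have h4 : (s i : ℝ) * f i x = 0 := by linarith
      rcases mul_eq_zero.1 h4 with h5 | h5
      · apply (hF.le hx i).2
        cases hs : s i <;> simp_all
      · exact h5
    have := hmax ⟨⟨x + y, add_mem hx hy⟩, rfl⟩ hle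
    exact this (show f j (x + y) ≠ 0 by rwa [map_add, hj, zero_add]) hj
  refine ⟨fun j => if f j x = 0 then 0 else s j, le_antisymm (fun y hy j => ?_) fun y hy => ?_⟩
  · dsimp only
    split_ifs with h
    · simp [hzero y hy j h]
    · exact hF.le hy j
  · have hy' : y ∈ signCone f s :=
      (signCone_isFaceOf fun j => by split_ifs <;> simp).le hy
    have hxy : ∀ j, f j x = 0 → f j y = 0 := fun j hj => (hy j).2 (by simp [hj])
    obtain ⟨ε, hε, hmem⟩ := exists_pos_sub_smul_mem_signCone (hF.le hx) hy' hxy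
    exact hF.mem_of_smul_add_mem hy' hmem hε (by rwa [add_sub_cancel])

/-- The sign cones of a finite family of linear functionals form a polyhedral fan. -/
theorem isPolyhedralFan_range_signCone [Finite ι] (f : ι → Module.Dual ℝ E) :
    IsPolyhedralFan (Set.range (signCone f)) where
  finite := Set.finite_range _
  polyhedral := by
    rintro _ ⟨s, rfl⟩
    exact signCone_dualFG f s
  face_mem := by
    rintro _ ⟨s, rfl⟩ F hF
    obtain ⟨t, rfl⟩ := hF.eq_signCone
    exact ⟨t, rfl⟩
  inter_isFaceOf := by
    rintro _ ⟨s, rfl⟩ _ ⟨t, rfl⟩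
    rw [signCone_inf]
    constructor <;> refine signCone_isFaceOf fun j => ?_ <;> split_ifs with h <;>
      simp [h]

theorem covers_range_signCone (f : ι → Module.Dual ℝ E) : Covers (Set.range (signCone f)) :=
  fun x => ⟨_, ⟨fun j => SignType.sign (f j x), rfl⟩, fun j => ⟨by simp, by simp⟩⟩

/-- Near a zero, a nonzero functional takes both signs, but on the cone its sign is prescribed. -/
theorem apply_ne_zero_of_mem_interior_signCone [TopologicalSpace E] [ContinuousAdd E]
    [ContinuousSMul ℝ E] {f : ι → Module.Dual ℝ E} {s : ι → SignType} {x : E}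
    (hx : x ∈ interior (signCone f s : Set E)) {j : ι} (hj : f j ≠ 0) : f j x ≠ 0 := by
  intro h0
  obtain ⟨z, hz⟩ : ∃ z, f j z ≠ 0 := by
    by_contra! h
    exact hj (LinearMap.ext h)
  have hc : Continuous fun ε : ℝ => x + ε • z := by fun_prop
  have hmem : (fun ε : ℝ => x + ε • z) ⁻¹' interior (signCone f s : Set E) ∈ nhds (0 : ℝ) :=
    (isOpen_interior.preimage hc).mem_nhds (by simpa using hx)
  obtain ⟨ε, hε, hball⟩ := Metric.mem_nhds_iff.1 hmem
  have h1 : x + (ε / 2) • z ∈ signCone f s :=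
    interior_subset (hball (by simp [abs_of_pos hε]; linarith))
  have h2 : x + (-(ε / 2)) • z ∈ signCone f s :=
    interior_subset (hball (by simp [abs_of_pos hε]; linarith))
  have h3 := h1 j
  have h4 := h2 j
  simp only [map_add, map_smul, h0, zero_add, smul_eq_mul] at h3 h4
  have h5 : (s j : ℝ) * (ε / 2 * f j z) = 0 := by linarith [h3.1, h4.1]
  rcases mul_eq_zero.1 h5 with h6 | h6
  · have hs : s j = 0 := by cases hs : s j <;> simp_all
    exact mul_ne_zero (by positivity) hz (h3.2 hs)
  · exact mul_ne_zero (by positivity) hz h6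

end SignCone

/-! ### Averages and closed classes of Markov chains. -/

section Stochastic

variable {S : Type*} [Fintype S]

theorem stdSimplex.le_sum_mul {p : S → ℝ} (hp : p ∈ stdSimplex ℝ S) {w : S → ℝ} {m : ℝ}
    (h : ∀ j, p j ≠ 0 → m ≤ w j) : m ≤ ∑ j, p j * w j := by
  calc m = ∑ j, p j * m := by rw [← Finset.sum_mul, hp.2, one_mul]
    _ ≤ ∑ j, p j * w j := Finset.sum_le_sum fun j _ => by
      by_cases hj : p j = 0
      · simp [hj]
      · exact mul_le_mul_of_nonneg_left (h j hj) (hp.1 j)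

theorem stdSimplex.sum_mul_le {p : S → ℝ} (hp : p ∈ stdSimplex ℝ S) {w : S → ℝ} {m : ℝ}
    (h : ∀ j, p j ≠ 0 → w j ≤ m) : ∑ j, p j * w j ≤ m := by
  have := stdSimplex.le_sum_mul hp (w := fun j => -w j) (m := -m) fun j hj => neg_le_neg (h j hj)
  simp only [mul_neg, Finset.sum_neg_distrib] at this
  linarith

theorem stdSimplex.eq_of_sum_mul_le {p : S → ℝ} (hp : p ∈ stdSimplex ℝ S) {w : S → ℝ} {m : ℝ}
    (h : ∀ j, p j ≠ 0 → m ≤ w j) (hle : ∑ j, p j * w j ≤ m) {j : S} (hj : p j ≠ 0) :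
    w j = m := by
  have h0 : ∑ j, p j * (w j - m) ≤ 0 := by
    simp only [mul_sub, Finset.sum_sub_distrib, ← Finset.sum_mul, hp.2]
    linarith
  have hnn : ∀ j ∈ Finset.univ, 0 ≤ p j * (w j - m) := fun j _ => by
    by_cases hj : p j = 0
    · simp [hj]
    · exact mul_nonneg (hp.1 j) (sub_nonneg.2 (h j hj))
  have := (Finset.sum_eq_zero_iff_of_nonneg hnn).1 (le_antisymm h0 (Finset.sum_nonneg hnn)) j
    (Finset.mem_univ j)
  rcases mul_eq_zero.1 this with h1 | h1
  · exact absurd h1 hj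
  · linarith

/-- A nonempty set of states that the chain with transition probabilities `Q` never leaves. -/
def IsClosedClass (Q : S → stdSimplex ℝ S) (C : Set S) : Prop :=
  C.Nonempty ∧ ∀ i ∈ C, ∀ j, (Q i).1 j ≠ 0 → j ∈ C

/-- Minimum principle: at a minimiser, the average over successors cannot exceed the minimum, so all
successors are minimisers. -/
theorem isClosedClass_argmin [Nonempty S] {Q : S → stdSimplex ℝ S} {w : S → ℝ}
    (hw : ∀ i, ∑ j, (Q i).1 j * w j ≤ w i) : IsClosedClass Q {i | ∀ j, w i ≤ w j} := by
  refine ⟨Finite.exists_min w, fun i hi j hj k => ?_⟩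
  rw [stdSimplex.eq_of_sum_mul_le (Q i).2 (fun l _ => hi l) (hw i) hj]
  exact hi k

end Stochastic

/-! ### Poisson equations, generic payments and comparison of eigenvalues. -/

namespace Game

section

variable {S : Type*} [Fintype S] {A : S → Type*} {B : ∀ i, A i → Type*}
  (P : ∀ (i : S) (a : A i), B i a → stdSimplex ℝ S) (r : Payment B)

/-- Pairs of policies of the two players, restricted to the states and actions that occur. -/
abbrev JointPolicy {S : Type*} {A : S → Type*} (B : ∀ i, A i → Type*) : Type _ :=
  ∀ i, Σ a : A i, B i a

/-- The transition probabilities under a joint policy. -/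
def chain (ρ : JointPolicy B) (i : S) : stdSimplex ℝ S := P i (ρ i).1 (ρ i).2

/-- `lam` and `u` solve the Poisson equation of the joint policy `ρ`. -/
def IsPoisson (ρ : JointPolicy B) (lam : ℝ) (u : S → ℝ) : Prop :=
  ∀ i, r i (ρ i).1 (ρ i).2 + ∑ j, (chain P ρ i).1 j * u j = lam + u i

/-- The payments for which the Poisson equations of `ρ` and `ρ'` are solvable with a common
eigenvalue. -/
def commonValue (ρ ρ' : JointPolicy B) : Submodule ℝ (Payment B) where
  carrier := {r | ∃ lam u u', IsPoisson P r ρ lam u ∧ IsPoisson P r ρ' lam u'}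
  zero_mem' := ⟨0, 0, 0, fun i => by simp, fun i => by simp⟩
  add_mem' := by
    rintro r s ⟨l, u, u', h, h'⟩ ⟨m, v, v', k, k'⟩
    refine ⟨l + m, u + v, u' + v', fun i => ?_, fun i => ?_⟩
    · simp only [Pi.add_apply, mul_add, Finset.sum_add_distrib]
      linear_combination h i + k i
    · simp only [Pi.add_apply, mul_add, Finset.sum_add_distrib]
      linear_combination h' i + k' i
  smul_mem' := by
    rintro c r ⟨l, u, u', h, h'⟩
    refine ⟨c * l, c • u, c • u', fun i => ?_, fun i => ?_⟩
    · simp only [Pi.smul_apply, smul_eq_mul, mul_left_comm _ c, ← Finset.mul_sum]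
      linear_combination c * h i
    · simp only [Pi.smul_apply, smul_eq_mul, mul_left_comm _ c, ← Finset.mul_sum]
      linear_combination c * h' i

/-- The payment `r` lies in `commonValue P ρ ρ'` only when every payment does. -/
def IsGeneric : Prop := ∀ ρ ρ' : JointPolicy B, r ∈ commonValue P ρ ρ' → commonValue P ρ ρ' = ⊤

variable {P r}

/-- When Poisson equations for the indicator payment of a state `i` in a minimal closed class of
`ρ` and for `ρ'` have a common eigenvalue, `i` belongs to all closed classes of `ρ'`. -/
theorem mem_of_commonValue_eq_top {ρ ρ' : JointPolicy B} (h : commonValue P ρ ρ' = ⊤)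
    {C C' : Set S} (hC : Minimal (IsClosedClass (chain P ρ)) C)
    (hC' : IsClosedClass (chain P ρ') C') {i : S} (hi : i ∈ C) : i ∈ C' := by
  classical
  obtain ⟨lam, u, u', hu, hu'⟩ : (fun k _ _ => if k = i then 1 else 0 : Payment B) ∈
      commonValue P ρ ρ' := h ▸ Submodule.mem_top
  by_contra hiC'
  obtain ⟨k, hk, hmax⟩ := C'.exists_max_image u' C'.toFinite hC'.1
  -- The payment vanishes on `C'`, so a maximiser of `u'` there bounds the eigenvalue above.
  have hlam : lam ≤ 0 := by
    have h1 := hu' k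
    have hki : k ≠ i := fun hki => hiC' (hki ▸ hk)
    simp only [if_neg hki] at h1
    have := stdSimplex.sum_mul_le (chain P ρ' k).2 fun j hj => hmax j (hC'.2 k hk j hj)
    linarith
  obtain ⟨m, hm, hmin⟩ := C.exists_min_image u C.toFinite hC.1.1
  -- As `lam ≤ 0` and the payment is nonnegative, `u` is superharmonic on `C`. Minimality of `C`
  -- makes `u` constant there, and the equation at `i` then forces `1 ≤ lam`.
  have hD : IsClosedClass (chain P ρ) {k ∈ C | u k = u m} := by
    refine ⟨⟨m, hm, rfl⟩, fun k hk j hj => ⟨hC.1.2 k hk.1 j hj, ?_⟩⟩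
    refine stdSimplex.eq_of_sum_mul_le (chain P ρ k).2
      (fun l hl => hmin l (hC.1.2 k hk.1 l hl)) ?_ hj
    have h1 := hu k
    have h2 : (0 : ℝ) ≤ if k = i then 1 else 0 := by split_ifs <;> norm_num
    linarith [hk.2]
  have him := (hC.2 hD (Set.sep_subset _ _) hi).2
  have h1 := hu i
  simp only [if_true] at h1
  have := stdSimplex.le_sum_mul (chain P ρ i).2 fun j hj => hmin j (hC.1.2 i hi j hj)
  linarith

theorem IsGeneric.exists_mem_isClosedClass [Nonempty S] (hr : IsGeneric P r) {ρ : JointPolicy B}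
    {lam : ℝ} {u : S → ℝ} (hu : IsPoisson P r ρ lam u) :
    ∃ i, ∀ ρ' u', IsPoisson P r ρ' lam u' → ∀ C, IsClosedClass (chain P ρ') C → i ∈ C := by
  obtain ⟨C, hC⟩ := exists_minimal_of_wellFoundedLT (IsClosedClass (chain P ρ))
    ⟨Set.univ, Set.univ_nonempty, fun _ _ _ _ => Set.mem_univ _⟩
  obtain ⟨i, hi⟩ := hC.1.1
  exact ⟨i, fun ρ' u' hu' C' hC' =>
    mem_of_commonValue_eq_top (hr ρ ρ' ⟨lam, u, u', hu, hu'⟩) hC hC' hi⟩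

variable [∀ i a, Fintype (B i a)] [∀ i a, Nonempty (B i a)]

theorem exists_jointPolicy_isPoisson {σ : Policy A} {lam : ℝ} {u : S → ℝ}
    (hu : IsEigenpair (policyOp P r σ) lam u) :
    ∃ ρ : JointPolicy B, (∀ i, (ρ i).1 = σ i) ∧ IsPoisson P r ρ lam u := by
  have h : ∀ i, ∃ b : B i (σ i), r i (σ i) b + ∑ j, (P i (σ i) b).1 j * u j = lam + u i := by
    intro i
    obtain ⟨b, -, hb⟩ := Finset.exists_mem_eq_sup' (Finset.univ_nonempty (α := B i (σ i)))
      fun b => r i (σ i) b + ∑ j, (P i (σ i) b).1 j * u j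
    exact ⟨b, hb ▸ hu i⟩
  choose b hb using h
  exact ⟨fun i => ⟨σ i, b i⟩, fun _ => rfl, hb⟩

theorem le_policyOp (σ : Policy A) (x : S → ℝ) {ρ : JointPolicy B} (hρ : ∀ i, (ρ i).1 = σ i)
    (i : S) : r i (ρ i).1 (ρ i).2 + ∑ j, (chain P ρ i).1 j * x j ≤ policyOp P r σ x i := by
  unfold policyOp chain
  rw [← hρ i]
  exact Finset.le_sup' (fun b => r i (ρ i).1 b + ∑ j, (P i (ρ i).1 b).1 j * x j)
    (Finset.mem_univ (ρ i).2)

theorem IsPoisson.sum_mul_sub_le {σ : Policy A} {ρ : JointPolicy B} {lam mu : ℝ} {u x : S → ℝ}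
    (hu : IsPoisson P r ρ lam u) (hρ : ∀ i, (ρ i).1 = σ i)
    (hx : ∀ i, policyOp P r σ x i ≤ mu + x i) (i : S) :
    ∑ j, (chain P ρ i).1 j * (x j - u j) ≤ mu - lam + (x i - u i) := by
  have h1 := (le_policyOp σ x hρ i).trans (hx i)
  have h2 := hu i
  simp only [mul_sub, Finset.sum_sub_distrib]
  linarith

/-- Evaluate `IsPoisson.sum_mul_sub_le` at a minimiser of `x - u`. -/
theorem eigenvalue_le_of_policyOp_le [Nonempty S] {σ : Policy A} {lam mu : ℝ} {u x : S → ℝ}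
    (hu : IsEigenpair (policyOp P r σ) lam u) (hx : ∀ i, policyOp P r σ x i ≤ mu + x i) :
    lam ≤ mu := by
  obtain ⟨ρ, hρ, hρu⟩ := exists_jointPolicy_isPoisson hu
  obtain ⟨i, hi⟩ := Finite.exists_min fun i => x i - u i
  have h1 := hρu.sum_mul_sub_le hρ hx i
  have h2 := stdSimplex.le_sum_mul (chain P ρ i).2 (w := fun i => x i - u i) fun j _ => hi j
  linarith

theorem WellPosed.reached_of_forall_not_stopsAt {σ : ℕ → Policy A} (hwp : WellPosed P r σ)
    (hns : ∀ k, ¬ StopsAt P r σ k) (k : ℕ) : Reached P r σ k := by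
  induction k with
  | zero => exact fun j hj => absurd hj (Nat.not_lt_zero j)
  | succ k ih =>
    intro j hj
    rcases Nat.lt_succ_iff_lt_or_eq.1 hj with hj | rfl
    · exact ih j hj
    · exact ⟨hwp _ ih, fun h => hns _ ⟨ih, hwp _ ih, h⟩⟩

end

/-! ### Termination for generic payments. -/

section

variable {S : Type*} [Fintype S] {A : S → Type*} [∀ i, Fintype (A i)] [∀ i, Nonempty (A i)]
  {B : ∀ i, A i → Type*} [∀ i a, Fintype (B i a)] [∀ i a, Nonempty (B i a)]
  {P : ∀ (i : S) (a : A i), B i a → stdSimplex ℝ S} {r : Payment B}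
  {σ : ℕ → Policy A} {lam : ℕ → ℝ} {v : ℕ → S → ℝ}

theorem shapley_le_policyOp (σ : Policy A) (x : S → ℝ) (i : S) :
    shapley P r x i ≤ policyOp P r σ x i :=
  Finset.inf'_le _ (Finset.mem_univ (σ i))

theorem IsExecution.isEigenpair_of_stopsAt (hex : IsExecution P r σ lam v) {k : ℕ}
    (hk : StopsAt P r σ k) : IsEigenpair (shapley P r) (lam k) (v k) := by
  rw [IsEigenpair, hex.optimal k hk.1 hk.2.1, hk.2.2]
  exact hex.eigenpair k hk.1 hk.2.1

/-- For a generic payment every well-posed execution of Hoffman–Karp policy iteration stops. -/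
theorem IsGeneric.exists_stopsAt (hr : IsGeneric P r) (hex : IsExecution P r σ lam v)
    (hwp : WellPosed P r σ) : ∃ k, StopsAt P r σ k := by
  by_contra! hns
  have hreach := hwp.reached_of_forall_not_stopsAt hns
  have heig : ∀ k, IsEigenpair (policyOp P r (σ k)) (lam k) (v k) := fun k =>
    hex.eigenpair k (hreach k) (hwp k (hreach k))
  have hne : ∀ k, σ (k + 1) ≠ σ k := fun k h => hns k ⟨hreach k, hwp k (hreach k), h⟩
  cases isEmpty_or_nonempty S
  · exact hne 0 (Subsingleton.elim _ _)
  have himp : ∀ k i, policyOp P r (σ (k + 1)) (v k) i ≤ lam k + v k i := fun k i => by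
    rw [← hex.optimal k (hreach k) (hwp k (hreach k)), ← heig k i]
    exact shapley_le_policyOp _ _ _
  have hanti : Antitone lam := antitone_nat_of_succ_le fun k =>
    eigenvalue_le_of_policyOp_le (heig (k + 1)) (himp k)
  obtain ⟨k, l, hkl, hσ⟩ : ∃ k l, k < l ∧ σ k = σ l := by
    obtain ⟨k, l, hkl, hσ⟩ := Finite.exists_ne_map_eq_of_infinite σ
    rcases lt_or_gt_of_ne hkl with h | h
    · exact ⟨k, l, h, hσ⟩
    · exact ⟨l, k, h, hσ.symm⟩
  have hlam : lam k ≤ lam l := eigenvalue_le_of_policyOp_le (heig k) fun i => hσ ▸ (heig l i).le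
  have hconst : ∀ j, k ≤ j → j ≤ l → lam j = lam k := fun j hkj hjl =>
    le_antisymm (hanti hkj) (hlam.trans (hanti hjl))
  choose ρ hρσ hρ using fun j => exists_jointPolicy_isPoisson (heig j)
  obtain ⟨i, hi⟩ := hr.exists_mem_isClosedClass (hρ k)
  -- A subsolution minus the bias `v j` is superharmonic for `ρ j`, so the common state `i`
  -- minimises it.
  have harg : ∀ j, k ≤ j → j ≤ l → ∀ x : S → ℝ,
      (∀ s, policyOp P r (σ j) x s ≤ lam k + x s) → ∀ s, x i - v j i ≤ x s - v j s := by
    intro j hkj hjl x hx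
    refine hi (ρ j) (v j) (hconst j hkj hjl ▸ hρ j) {s | ∀ t, x s - v j s ≤ x t - v j t}
      (isClosedClass_argmin fun s => ?_)
    have := (hρ j).sum_mul_sub_le (hρσ j) hx s
    rwa [hconst j hkj hjl, sub_self, zero_add] at this
  have hstep : ∀ j, k ≤ j → j < l → ∀ s, v j i - v (j + 1) i ≤ v j s - v (j + 1) s :=
    fun j hkj hjl => harg (j + 1) (by omega) hjl (v j) fun s =>
      hconst j hkj hjl.le ▸ himp j s
  have hchain : ∀ j, k + 1 ≤ j → j ≤ l → ∀ s, v (k + 1) i - v j i ≤ v (k + 1) s - v j s := by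
    intro j hj
    induction j, hj using Nat.le_induction with
    | base => exact fun _ s => by simp
    | succ j hj ih =>
      intro hjl s
      linarith [ih (by omega) s, hstep j (by omega) (by omega) s]
  -- Since `σ k = σ l`, the bias `v l` is also one for `σ k`; this reverses the telescoped
  -- inequality.
  have hback : ∀ s, v l i - v k i ≤ v l s - v k s := harg k le_rfl hkl.le (v l) fun s => by
    rw [hσ, heig l s, hconst l hkl.le le_rfl]
  have heq : ∀ s, v k s = v (k + 1) s + (v k i - v (k + 1) i) := fun s => by
    linarith [hback s, hchain l hkl le_rfl s, hstep k le_rfl hkl s]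
  -- The biases `v k` and `v (k + 1)` differ by a constant, so `σ (k + 1)` does no better than `σ k`
  -- at `v k`.
  refine hne k (hex.conservative k (hreach k) (hwp k (hreach k)) (funext fun s => ?_))
  refine le_antisymm (shapley_le_policyOp _ _ _) ?_
  rw [hex.optimal k (hreach k) (hwp k (hreach k)), heig k s]
  have h1 := le_policyOp (σ (k + 1)) (v k) (P := P) (r := r) (hρσ (k + 1)) s
  have h2 := hρ (k + 1) s
  have h3 : ∑ j, (chain P (ρ (k + 1)) s).1 j * v k j =
      ∑ j, (chain P (ρ (k + 1)) s).1 j * v (k + 1) j + (v k i - v (k + 1) i) := by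
    rw [Finset.sum_congr rfl fun j _ => by rw [heq j]]
    simp only [mul_add, Finset.sum_add_distrib, ← Finset.sum_mul, (chain P (ρ (k + 1)) s).2.2,
      one_mul]
  linarith [heq s, hconst (k + 1) (by omega) hkl]

end

end Game

theorem mainTheorem4 {S : Type*} [Fintype S]
    {A : S → Type*} [∀ i, Fintype (A i)] [∀ i, Nonempty (A i)]
    {B : ∀ i, A i → Type*} [∀ i a, Fintype (B i a)] [∀ i a, Nonempty (B i a)]
    (P : ∀ (i : S) (a : A i), B i a → stdSimplex ℝ S) :
    ∃ K : Set (PointedCone ℝ (Game.Payment B)),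
      IsPolyhedralFan K ∧ Covers K ∧
      ∀ C ∈ K, IsFullDimensional C → ∀ r ∈ interior (C : Set (Game.Payment B)),
        ∀ (σ : ℕ → Game.Policy A) (lam : ℕ → ℝ) (v : ℕ → S → ℝ),
          Game.IsExecution P r σ lam v → Game.WellPosed P r σ →
            ∃ k, Game.StopsAt P r σ k ∧
              IsEigenpair (Game.shapley P r) (lam k) (v k) := by
  have hf : ∀ q : Game.JointPolicy B × Game.JointPolicy B, ∃ f : Module.Dual ℝ (Game.Payment B),
      Game.commonValue P q.1 q.2 ≤ LinearMap.ker f ∧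
        (Game.commonValue P q.1 q.2 ≠ ⊤ → f ≠ 0) := by
    intro q
    by_cases hq : Game.commonValue P q.1 q.2 = ⊤
    -- The zero functional imposes no wall for such a pair.
    · exact ⟨0, by simp, fun h => absurd hq h⟩
    · obtain ⟨f, hf, hle⟩ := Submodule.exists_le_ker_of_lt_top _ (lt_top_iff_ne_top.2 hq)
      exact ⟨f, hle, fun _ => hf⟩
  choose f hle hne using hf
  refine ⟨Set.range (signCone f), isPolyhedralFan_range_signCone f, covers_range_signCone f, ?_⟩
  rintro _ ⟨s, rfl⟩ - r hr σ lam v hex hwp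
  have hgen : Game.IsGeneric P r := by
    intro ρ ρ' hmem
    by_contra htop
    exact apply_ne_zero_of_mem_interior_signCone hr (hne (ρ, ρ') htop) (hle (ρ, ρ') hmem)
  obtain ⟨k, hk⟩ := hgen.exists_stopsAt hex hwp
  exact ⟨k, hk, hex.isEigenpair_of_stopsAt hk⟩
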